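/- For each integer $n\ge 0$ let $B_n(x)$ be the $n$th Bernoulli polynomial, defined by $$\sum_{n\ge 0}\frac{B_n(x)}{n!}u^n=\frac{ue^{ux}}{e^u-1},\qquad |u|<2\pi,$$ and let $B_n:=B_n(0)$ be the $n$th Bernoulli number. Empty sums are $0$. Let $m_1,m_2\ge 0$ be integers, $t>0$ and $x\in(0,1/2)$. Then $$\exp\left(\sum_{\ell=1}^{2m_1+1}\frac{B_{2\ell}(x)-B_{2\ell}}{\ell(2\ell-1)}\frac{1}{t^{2\ell-1}}\right) < \frac{\Gamma(t+1-x)\Gamma(t+x)}{\Gamma(t)\Gamma(t+1)} < \exp\left(\sum_{\ell=1}^{2m_2}\frac{B_{2\ell}(x)-B_{2\ell}}{\ell(2\ell-1)}\frac{1}{t^{2\ell-1}}\right)$$ and $$\exp\left(\sum_{\ell=1}^{2m_1}\frac{B_{2\ell+1}(x)}{\ell(2\ell+1)}\frac{1}{t^{2\ell}}\right) < \frac{\Gamma(t+1-x)}{t^{1-2x}\Gamma(t+x)} < \exp\left(\sum_{\ell=1}^{2m_2+1}\frac{B_{2\ell+1}(x)}{\ell(2\ell+1)}\frac{1}{t^{2\ell}}\right).$$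 -/

import Mathlib

open Filter Topology MeasureTheory Set

/-! ### Forward differences -/

/-! Take logarithms and let `Φ t` be the log of the Gamma quotient minus a truncated sum, up to
sign. The forward difference of the Gamma part consists of logarithms of linear functions, so its
derivative is a sum of terms `c / (t + a)`, each a Laplace transform of an exponential. The terms `1
/ t ^ k` likewise give multiples of `u ^ k * (1 - exp (-u))`. The combined kernel factors as `(1 -
exp (-u)) * (2 / u)`, which is positive, times a remainder of the Bernoulli generating function: its
odd part for the second pair of bounds, its even part for the first (`odd_kernel_eq`,
`even_kernel_eq`).

These remainders have a fixed sign on `(0, 1/2)`, alternating with the order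
(`bernoulliOddRem_sign`, `bernoulliEvenRem_sign`): differentiating twice in `x` lowers the order by
one, and the odd remainders vanish at `0` and `1/2`. Hence the forward difference of `Φ` is strictly
monotone in `t`. Since `Φ (t + n)` tends to `0`, that monotonicity fixes the sign of the difference
and then of `Φ`. -/

/-- A function that vanishes at infinity along every progression `t + n`, and whose forward
difference has positive derivative, is positive. -/
theorem pos_of_deriv_forward_difference_pos {Φ Δ d : ℝ → ℝ}
    (hΔ : ∀ t, 0 < t → Φ (t + 1) - Φ t = Δ t)
    (hderiv : ∀ t, 0 < t → HasDerivAt Δ (d t) t) (hd : ∀ t, 0 < t → 0 < d t)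
    (hlim : ∀ t, 0 < t → Tendsto (fun n : ℕ => Φ (t + n)) atTop (𝓝 0)) {t : ℝ} (ht : 0 < t) :
    0 < Φ t := by
  have hmono : StrictMonoOn Δ (Ioi 0) := by
    refine strictMonoOn_of_deriv_pos (convex_Ioi 0)
      (fun s hs => (hderiv s hs).continuousAt.continuousWithinAt) fun s hs => ?_
    rw [interior_Ioi] at hs
    rw [(hderiv s hs).deriv]
    exact hd s hs
  have hpos : ∀ {s : ℝ}, 0 < s → ∀ n : ℕ, 0 < s + n := fun hs n => by positivity
  have hΔlim : ∀ s, 0 < s → Tendsto (fun n : ℕ => Δ (s + n)) atTop (𝓝 0) := by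
    intro s hs
    have h := (hlim (s + 1) (by linarith)).sub (hlim s hs)
    rw [sub_zero] at h
    refine h.congr fun n => ?_
    rw [← hΔ _ (hpos hs n)]
    congr 2
    ring
  have hΔneg : ∀ s, 0 < s → Δ s < 0 := by
    intro s hs
    -- Passing to the limit only gives `≤ 0`; the unit step supplies the strictness.
    have h1 : Δ s < Δ (s + 1) := hmono hs (by simp only [mem_Ioi]; linarith) (by linarith)
    have h2 : Δ (s + 1) ≤ 0 := by
      have hm : Monotone fun n : ℕ => Δ (s + 1 + n) := by
        intro m n hmn
        refine hmono.monotoneOn (hpos (by linarith) m) (hpos (by linarith) n) ?_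
        have : (m : ℝ) ≤ n := by exact_mod_cast hmn
        linarith
      simpa using hm.ge_of_tendsto (hΔlim (s + 1) (by linarith)) 0
    linarith
  have hanti : Antitone fun n : ℕ => Φ (t + 1 + n) := by
    refine antitone_nat_of_succ_le fun n => ?_
    have hp := hpos (s := t + 1) (by linarith) n
    have h1 := hΔ _ hp
    have h2 := hΔneg _ hp
    have h3 : t + 1 + ((n + 1 : ℕ) : ℝ) = t + 1 + n + 1 := by push_cast; ring
    rw [h3]
    linarith
  have h0 : 0 ≤ Φ (t + 1) := by
    simpa using hanti.le_of_tendsto (hlim (t + 1) (by linarith)) 0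
  have h1 := hΔ t ht
  have h2 := hΔneg t ht
  linarith

/-! ### Laplace transforms -/

/-- The Laplace integral of `f` at `t` converges absolutely, with value `v`. -/
def HasLaplaceAt (f : ℝ → ℝ) (t v : ℝ) : Prop :=
  IntegrableOn (fun u => f u * Real.exp (-(t * u))) (Ioi 0) ∧
    ∫ u in Ioi 0, f u * Real.exp (-(t * u)) = v

namespace HasLaplaceAt

variable {f g : ℝ → ℝ} {t v w : ℝ}

theorem add (hf : HasLaplaceAt f t v) (hg : HasLaplaceAt g t w) :
    HasLaplaceAt (fun u => f u + g u) t (v + w) := by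
  simp only [HasLaplaceAt, add_mul]
  exact ⟨hf.1.add hg.1, by rw [integral_add hf.1 hg.1, hf.2, hg.2]⟩

theorem const_mul (hf : HasLaplaceAt f t v) (c : ℝ) :
    HasLaplaceAt (fun u => c * f u) t (c * v) := by
  simp only [HasLaplaceAt, mul_assoc]
  exact ⟨hf.1.const_mul c, by rw [integral_const_mul, hf.2]⟩

theorem sub (hf : HasLaplaceAt f t v) (hg : HasLaplaceAt g t w) :
    HasLaplaceAt (fun u => f u - g u) t (v - w) := by
  simp only [HasLaplaceAt, sub_mul]
  exact ⟨hf.1.sub hg.1, by rw [integral_sub hf.1 hg.1, hf.2, hg.2]⟩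

theorem sum {ι : Type*} {s : Finset ι} {F : ι → ℝ → ℝ} {V : ι → ℝ}
    (h : ∀ i ∈ s, HasLaplaceAt (F i) t (V i)) :
    HasLaplaceAt (fun u => ∑ i ∈ s, F i u) t (∑ i ∈ s, V i) := by
  simp only [HasLaplaceAt, Finset.sum_mul]
  refine ⟨integrable_finsetSum s fun i hi => (h i hi).1, ?_⟩
  rw [integral_finsetSum s fun i hi => (h i hi).1]
  exact Finset.sum_congr rfl fun i hi => (h i hi).2

theorem pos (hf : HasLaplaceAt f t v) (hpos : ∀ u, 0 < u → 0 < f u) : 0 < v := by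
  rw [← hf.2, setIntegral_pos_iff_support_of_nonneg_ae _ hf.1]
  · have : Function.support (fun u => f u * Real.exp (-(t * u))) ∩ Ioi 0 = Ioi 0 := by
      refine inter_eq_right.2 fun u hu => ?_
      exact (mul_pos (hpos u hu) (Real.exp_pos _)).ne'
    rw [this]
    simp
  · refine (ae_restrict_iff' measurableSet_Ioi).2 (Eventually.of_forall fun u hu => ?_)
    exact (mul_pos (hpos u hu) (Real.exp_pos _)).le

theorem pow_mul_exp (k : ℕ) {a t : ℝ} (h : 0 < t + a) :
    HasLaplaceAt (fun u => u ^ k * Real.exp (-(a * u))) t (k.factorial / (t + a) ^ (k + 1)) := by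
  have key : ∀ u : ℝ, u ^ k * Real.exp (-(a * u)) * Real.exp (-(t * u))
      = u ^ (k : ℝ) * Real.exp (-(t + a) * u ^ (1 : ℝ)) := by
    intro u
    rw [mul_assoc, ← Real.exp_add, Real.rpow_natCast, Real.rpow_one]
    ring_nf
  have hk : (-1 : ℝ) < k := by
    have : (0 : ℝ) ≤ k := k.cast_nonneg
    linarith
  simp only [HasLaplaceAt, key]
  refine ⟨integrableOn_rpow_mul_exp_neg_mul_rpow hk one_pos h, ?_⟩
  rw [integral_rpow_mul_exp_neg_mul_rpow one_pos hk h]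
  simp only [div_one, mul_one, Real.Gamma_nat_eq_factorial]
  rw [Real.rpow_neg h.le, ← Nat.cast_add_one, Real.rpow_natCast, div_eq_inv_mul]

theorem exp_neg {a t : ℝ} (h : 0 < t + a) :
    HasLaplaceAt (fun u => Real.exp (-(a * u))) t (1 / (t + a)) := by
  simpa using pow_mul_exp 0 h

theorem one {t : ℝ} (h : 0 < t) : HasLaplaceAt (fun _ => 1) t (1 / t) := by
  have := exp_neg (a := 0) (t := t) (by simpa using h)
  simpa using this

/-- For `k ≥ 1` the value is, up to a constant, the derivative of the forward difference of `1 / t ^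
k`, so this is the kernel contributed by one term of the expansion. -/
theorem pow_mul_one_sub_exp (k : ℕ) {t : ℝ} (h : 0 < t) :
    HasLaplaceAt (fun u => u ^ k * (1 - Real.exp (-u))) t
      (k.factorial * (1 / t ^ (k + 1) - 1 / (t + 1) ^ (k + 1))) := by
  have h1 := (pow_mul_exp k (a := 0) (t := t) (by simpa using h)).sub
    (pow_mul_exp k (a := 1) (t := t) (by linarith))
  simp only [zero_mul, neg_zero, Real.exp_zero, mul_one, add_zero, one_mul] at h1
  convert h1 using 1
  · ext u; ring
  · ring

end HasLaplaceAt

/-! ### Remainders of the generating function of the Bernoulli polynomials -/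

/-- The part of `u * exp (u * x) / (exp u - 1)` that is odd in `u`, minus the first `N` odd terms
of its expansion in Bernoulli polynomials. -/
noncomputable def bernoulliOddRem (u : ℝ) (N : ℕ) (x : ℝ) : ℝ :=
  u * Real.sinh ((x - 1 / 2) * u) / (2 * Real.sinh (u / 2)) -
    ∑ j ∈ Finset.range N, bernoulliFun (2 * j + 1) x * u ^ (2 * j + 1) / (2 * j + 1).factorial

/-- The part of `u * exp (u * x) / (exp u - 1)` that is even in `u`, minus the first `N + 1` even
terms of its expansion in Bernoulli polynomials, normalized to vanish at `x = 0`. -/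
noncomputable def bernoulliEvenRem (u : ℝ) (N : ℕ) (x : ℝ) : ℝ :=
  u * (Real.cosh ((x - 1 / 2) * u) - Real.cosh (u / 2)) / (2 * Real.sinh (u / 2)) -
    ∑ j ∈ Finset.range N, (bernoulliFun (2 * (j + 1)) x - bernoulli (2 * (j + 1))) *
      u ^ (2 * (j + 1)) / (2 * (j + 1)).factorial

theorem hasDerivAt_sub_half_mul (u x : ℝ) : HasDerivAt (fun y : ℝ => (y - 1 / 2) * u) u x := by
  simpa using ((hasDerivAt_id x).sub_const (1 / 2 : ℝ)).mul_const u

theorem hasDerivAt_bernoulliFun_succ_mul (k : ℕ) (c u x : ℝ) :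
    HasDerivAt (fun y => (bernoulliFun (k + 1) y - c) * u ^ (k + 1) / (k + 1).factorial)
      (u * (bernoulliFun k x * u ^ k / k.factorial)) x := by
  refine ((((hasDerivAt_bernoulliFun (k + 1) x).sub_const c).mul_const (u ^ (k + 1))).div_const
    ((k + 1).factorial : ℝ)).congr_deriv ?_
  rw [Nat.factorial_succ, Nat.add_sub_cancel]
  have h1 : (k.factorial : ℝ) ≠ 0 := by positivity
  have h2 : ((k : ℝ) + 1) ≠ 0 := by positivity
  push_cast
  field_simp
  ring

theorem hasDerivAt_bernoulliEvenRem (u : ℝ) (N : ℕ) (x : ℝ) :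
    HasDerivAt (bernoulliEvenRem u N) (u * bernoulliOddRem u N x) x := by
  have h1 := (((hasDerivAt_sub_half_mul u x).cosh.sub_const (Real.cosh (u / 2))).const_mul
    u).div_const (2 * Real.sinh (u / 2))
  have h2 : HasDerivAt (fun y => ∑ j ∈ Finset.range N,
      (bernoulliFun (2 * (j + 1)) y - bernoulli (2 * (j + 1))) *
      u ^ (2 * (j + 1)) / (2 * (j + 1)).factorial)
      (∑ j ∈ Finset.range N,
        u * (bernoulliFun (2 * j + 1) x * u ^ (2 * j + 1) / (2 * j + 1).factorial)) x :=
    HasDerivAt.fun_sum fun j _ => hasDerivAt_bernoulliFun_succ_mul (2 * j + 1) _ u x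
  refine (h1.sub h2).congr_deriv ?_
  rw [bernoulliOddRem, mul_sub, Finset.mul_sum]
  ring

/-- The odd remainder and the (normalized) even remainder of the previous order are related by
differentiation up to a constant. -/
theorem exists_hasDerivAt_bernoulliOddRem (u : ℝ) (N : ℕ) :
    ∃ c : ℝ, ∀ x, HasDerivAt (bernoulliOddRem u (N + 1)) (u * (bernoulliEvenRem u N x + c)) x := by
  -- This restores what the normalization at `x = 0` removed, and the `-1` comes from the term with
  -- `B_0 = 1`. Its value is irrelevant, since it disappears under a second differentiation.
  refine ⟨u * Real.cosh (u / 2) / (2 * Real.sinh (u / 2)) - 1 -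
    ∑ j ∈ Finset.range N, bernoulli (2 * (j + 1)) *
      u ^ (2 * (j + 1)) / (2 * (j + 1)).factorial, fun x => ?_⟩
  have h1 := ((hasDerivAt_sub_half_mul u x).sinh.const_mul u).div_const (2 * Real.sinh (u / 2))
  have h2 : HasDerivAt (fun y => ∑ j ∈ Finset.range (N + 1),
      bernoulliFun (2 * j + 1) y * u ^ (2 * j + 1) / (2 * j + 1).factorial)
      (∑ j ∈ Finset.range (N + 1), u * (bernoulliFun (2 * j) x * u ^ (2 * j) / (2 * j).factorial))
      x := by
    refine HasDerivAt.fun_sum fun j _ => ?_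
    simpa using hasDerivAt_bernoulliFun_succ_mul (2 * j) 0 u x
  refine (h1.sub h2).congr_deriv ?_
  rw [bernoulliEvenRem, ← Finset.mul_sum, Finset.sum_range_succ']
  have h3 : ∑ j ∈ Finset.range N, (bernoulliFun (2 * (j + 1)) x - bernoulli (2 * (j + 1))) *
      u ^ (2 * (j + 1)) / (2 * (j + 1)).factorial =
      ∑ j ∈ Finset.range N, bernoulliFun (2 * (j + 1)) x * u ^ (2 * (j + 1)) /
        (2 * (j + 1)).factorial -
      ∑ j ∈ Finset.range N, bernoulli (2 * (j + 1)) *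
        u ^ (2 * (j + 1)) / (2 * (j + 1)).factorial := by
    rw [← Finset.sum_sub_distrib]
    exact Finset.sum_congr rfl fun j _ => by ring
  rw [h3]
  simp only [mul_zero, bernoulliFun_zero, pow_zero, Nat.factorial_zero, Nat.cast_one, div_one,
    mul_one]
  ring

/-- The hyperbolic term equals `-u / 2` at `x = 0` and is cancelled by the `B_1` term, so at least
one term must be subtracted; the later odd Bernoulli numbers are zero. -/
theorem bernoulliOddRem_succ_zero {u : ℝ} (hu : 0 < u) (N : ℕ) :
    bernoulliOddRem u (N + 1) 0 = 0 := by
  have hs : Real.sinh (u / 2) ≠ 0 := (Real.sinh_pos_iff.2 (by linarith)).ne'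
  rw [bernoulliOddRem, Finset.sum_range_succ', Finset.sum_eq_zero]
  · have : (0 - 1 / 2) * u = -(u / 2) := by ring
    rw [this, Real.sinh_neg]
    simp only [mul_zero, zero_add, bernoulliFun_one, pow_one, Nat.factorial_one, Nat.cast_one]
    field_simp
    ring
  · intro j _
    rw [bernoulliFun_eval_zero, bernoulli_eq_zero_of_odd ⟨j + 1, rfl⟩ (by omega)]
    simp

theorem bernoulliOddRem_half (u : ℝ) (N : ℕ) : bernoulliOddRem u N (1 / 2) = 0 := by
  rw [bernoulliOddRem, Finset.sum_eq_zero]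
  · simp
  · intro j _
    rw [one_div, bernoulliFun_eval_half_eq_zero]
    simp

theorem bernoulliEvenRem_zero (u : ℝ) (N : ℕ) : bernoulliEvenRem u N 0 = 0 := by
  have : (0 - 1 / 2) * u = -(u / 2) := by ring
  rw [bernoulliEvenRem, this, Real.cosh_neg]
  simp [bernoulliFun_eval_zero]

/-- Strict concavity puts `g` above the chord joining its two zeros. -/
theorem pos_of_deriv2_neg {g g' g'' : ℝ → ℝ} {a b : ℝ} (hg : ∀ x, HasDerivAt g (g' x) x)
    (hg' : ∀ x, HasDerivAt g' (g'' x) x) (hneg : ∀ x ∈ Ioo a b, g'' x < 0) (ha : g a = 0)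
    (hb : g b = 0) {x : ℝ} (hx : x ∈ Ioo a b) : 0 < g x := by
  have hconc : StrictConcaveOn ℝ (Icc a b) g := by
    refine strictConcaveOn_of_deriv2_neg (convex_Icc a b)
      (fun y _ => (hg y).continuousAt.continuousWithinAt) fun y hy => ?_
    rw [interior_Icc] at hy
    have h1 : deriv g = g' := funext fun z => (hg z).deriv
    simpa [h1, (hg' y).deriv] using hneg y hy
  have hab : a < b := hx.1.trans hx.2
  have hmem : x ∈ openSegment ℝ a b := by rwa [openSegment_eq_Ioo hab]
  have := hconc.lt_on_openSegment (left_mem_Icc.2 hab.le) (right_mem_Icc.2 hab.le) hab.ne hmem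
  simpa [ha, hb] using this

/-- Induction on the order: the second derivative in `x` is `u ^ 2` times the previous remainder, so
the sign flips and the signed function is strictly concave with zeros at `0` and `1/2`. -/
theorem bernoulliOddRem_sign {u : ℝ} (hu : 0 < u) (N : ℕ) :
    ∀ x ∈ Ioo (0 : ℝ) (1 / 2), 0 < (-1) ^ (N + 1) * bernoulliOddRem u N x := by
  induction N with
  | zero =>
    intro x hx
    have hs : 0 < Real.sinh (u / 2) := Real.sinh_pos_iff.2 (by linarith)
    have hn : Real.sinh ((x - 1 / 2) * u) < 0 :=
      Real.sinh_neg_iff.2 (mul_neg_of_neg_of_pos (by linarith [hx.2]) hu)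
    have : u * Real.sinh ((x - 1 / 2) * u) / (2 * Real.sinh (u / 2)) < 0 :=
      div_neg_of_neg_of_pos (mul_neg_of_pos_of_neg hu hn) (by linarith)
    simpa [bernoulliOddRem] using this
  | succ N ih =>
    intro x hx
    obtain ⟨c, hc⟩ := exists_hasDerivAt_bernoulliOddRem u N
    refine pos_of_deriv2_neg (g := fun y => (-1) ^ (N + 1 + 1) * bernoulliOddRem u (N + 1) y)
      (fun y => (hc y).const_mul _)
      (fun y => (((hasDerivAt_bernoulliEvenRem u N y).add_const c).const_mul u).const_mul _)
      (fun y hy => ?_) ?_ ?_ hx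
    · have h1 := mul_pos (mul_pos hu hu) (ih y hy)
      have h2 : (-1 : ℝ) ^ (N + 1 + 1) * (u * (u * bernoulliOddRem u N y)) =
        -(u * u * ((-1) ^ (N + 1) * bernoulliOddRem u N y)) := by ring
      rw [h2]
      linarith
    · simp only [bernoulliOddRem_succ_zero hu, mul_zero]
    · simp only [bernoulliOddRem_half, mul_zero]

theorem bernoulliEvenRem_sign {u : ℝ} (hu : 0 < u) (N : ℕ) {x : ℝ}
    (hx : x ∈ Ioo (0 : ℝ) (1 / 2)) : 0 < (-1) ^ (N + 1) * bernoulliEvenRem u N x := by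
  have hd := fun y => (hasDerivAt_bernoulliEvenRem u N y).const_mul ((-1 : ℝ) ^ (N + 1))
  have hmono : StrictMonoOn (fun y => (-1) ^ (N + 1) * bernoulliEvenRem u N y)
      (Icc (0 : ℝ) (1 / 2)) := by
    refine strictMonoOn_of_deriv_pos (convex_Icc _ _)
      (fun y _ => (hd y).continuousAt.continuousWithinAt) fun y hy => ?_
    rw [interior_Icc] at hy
    rw [(hd y).deriv, mul_left_comm]
    exact mul_pos hu (bernoulliOddRem_sign hu N y hy)
  have := hmono (left_mem_Icc.2 (by norm_num)) (Ioo_subset_Icc_self hx) hx.1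
  simpa [bernoulliEvenRem_zero] using this

/-! ### Asymptotics of the Gamma function along arithmetic progressions -/

/-- This is Euler's limit for `Γ(a)`: the `n + 1` factors `a, ..., a + n` of its product are
absorbed into `Γ(a + n + 1)` by the functional equation. -/
theorem tendsto_log_Gamma_add_nat {a : ℝ} (ha : 0 < a) :
    Tendsto (fun n : ℕ => Real.log (Real.Gamma (a + (n + 1 : ℕ))) -
      a * Real.log n - Real.log n.factorial) atTop (𝓝 0) := by
  have h := (Real.BohrMollerup.tendsto_log_gamma ha).const_sub (Real.log (Real.Gamma a))
  rw [sub_self] at h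
  refine h.congr fun n => ?_
  have hfeq : ∀ {y : ℝ}, 0 < y →
      (Real.log ∘ Real.Gamma) (y + 1) = (Real.log ∘ Real.Gamma) y + Real.log y := by
    intro y hy
    simp only [Function.comp, Real.Gamma_add_one hy.ne']
    rw [Real.log_mul hy.ne' (Real.Gamma_pos_of_pos hy).ne', add_comm]
  have h1 := Real.BohrMollerup.f_add_nat_eq hfeq ha (n + 1)
  simp only [Function.comp] at h1
  rw [h1, Real.BohrMollerup.logGammaSeq]
  ring

theorem tendsto_log_add_nat_sub_log (a : ℝ) :
    Tendsto (fun n : ℕ => Real.log (a + (n + 1 : ℕ)) - Real.log n) atTop (𝓝 0) := by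
  have h : Tendsto (fun n : ℕ => 1 + (a + 1) / (n : ℝ)) atTop (𝓝 (1 + 0)) :=
    (tendsto_const_div_atTop_nhds_zero_nat (a + 1)).const_add 1
  rw [add_zero] at h
  have h' := (Real.continuousAt_log one_ne_zero).tendsto.comp h
  rw [Real.log_one] at h'
  refine h'.congr' ?_
  filter_upwards [eventually_gt_atTop 0,
    (tendsto_natCast_atTop_atTop (R := ℝ)).eventually_gt_atTop (-(a + 1))] with n hn hn'
  have hn0 : (0 : ℝ) < n := by exact_mod_cast hn
  have h1 : a + (n + 1 : ℕ) ≠ 0 := by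
    push_cast
    linarith
  rw [← Real.log_div h1 hn0.ne']
  simp only [Function.comp]
  congr 1
  push_cast
  field_simp
  ring

theorem tendsto_sum_mul_one_div_pow_add_nat (s : Finset ℕ) (c : ℕ → ℝ) (e : ℕ → ℕ)
    (he : ∀ l ∈ s, e l ≠ 0) (a : ℝ) :
    Tendsto (fun n : ℕ => ∑ l ∈ s, c l * (1 / (a + n) ^ e l)) atTop (𝓝 0) := by
  have h0 : Tendsto (fun n : ℕ => a + (n : ℝ)) atTop atTop :=
    tendsto_atTop_add_const_left _ _ tendsto_natCast_atTop_atTop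
  rw [← Finset.sum_const_zero (s := s)]
  refine tendsto_finsetSum s fun l hl => ?_
  rw [← mul_zero (c l)]
  refine Tendsto.const_mul _ ?_
  simp only [one_div]
  exact ((tendsto_pow_atTop (he l hl)).comp h0).inv_tendsto_atTop

theorem log_Gamma_add_one {s : ℝ} (hs : 0 < s) :
    Real.log (Real.Gamma (s + 1)) = Real.log s + Real.log (Real.Gamma s) := by
  rw [Real.Gamma_add_one hs.ne', Real.log_mul hs.ne' (Real.Gamma_pos_of_pos hs).ne']

theorem hasDerivAt_one_div_pow (k : ℕ) {t : ℝ} (ht : t ≠ 0) :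
    HasDerivAt (fun s : ℝ => 1 / s ^ k) (-(k : ℝ) * (1 / t ^ (k + 1))) t := by
  have h := hasDerivAt_zpow (-(k : ℤ)) t (Or.inl ht)
  simp only [zpow_neg, zpow_natCast] at h
  simp only [one_div]
  refine h.congr_deriv ?_
  have : (-(k : ℤ) - 1) = -((k + 1 : ℕ) : ℤ) := by push_cast; ring
  rw [this, zpow_neg, zpow_natCast]
  push_cast
  ring

/-! ### Comparison with truncated asymptotic expansions -/

/-- If the forward difference of `G` has as derivative the Laplace transform of `f`, and `f` minus
a polynomial multiple of `1 - exp (-u)` has the sign `ε`, then so has `G` minus the corresponding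
polynomial in `1 / t`. -/
theorem mul_sub_sum_pos_of_hasLaplaceAt {G Δ d f : ℝ → ℝ} {s : Finset ℕ} {c : ℕ → ℝ} {e : ℕ → ℕ}
    {ε : ℝ} (hΔ : ∀ t, 0 < t → G (t + 1) - G t = Δ t)
    (hderiv : ∀ t, 0 < t → HasDerivAt Δ (d t) t)
    (hf : ∀ t, 0 < t → HasLaplaceAt f t (d t))
    (hlim : ∀ t, 0 < t → Tendsto (fun n : ℕ => G (t + n)) atTop (𝓝 0))
    (he : ∀ l ∈ s, e l ≠ 0)
    (hsign : ∀ u, 0 < u → 0 < ε * (f u -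
      ∑ l ∈ s, c l * e l / (e l).factorial * (u ^ e l * (1 - Real.exp (-u)))))
    {t : ℝ} (ht : 0 < t) :
    0 < ε * (G t - ∑ l ∈ s, c l * (1 / t ^ e l)) := by
  refine pos_of_deriv_forward_difference_pos
    (Φ := fun t => ε * (G t - ∑ l ∈ s, c l * (1 / t ^ e l)))
    (Δ := fun t => ε * (Δ t - ∑ l ∈ s, c l * (1 / (t + 1) ^ e l - 1 / t ^ e l)))
    (d := fun t => ε * (d t - ∑ l ∈ s, c l * e l / (e l).factorial *
      ((e l).factorial * (1 / t ^ (e l + 1) - 1 / (t + 1) ^ (e l + 1)))))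
    (fun t ht => ?_) (fun t ht => ?_) (fun t ht => ?_) (fun t ht => ?_) ht
  · simp only [mul_sub, Finset.sum_sub_distrib, ← hΔ t ht]
    ring
  · have h : ∀ l ∈ s, HasDerivAt (fun t : ℝ => c l * (1 / (t + 1) ^ e l - 1 / t ^ e l))
        (c l * e l / (e l).factorial *
          ((e l).factorial * (1 / t ^ (e l + 1) - 1 / (t + 1) ^ (e l + 1)))) t := by
      intro l _
      have h1 := (hasDerivAt_one_div_pow (e l) (by linarith : t + 1 ≠ 0)).comp_add_const t 1
      refine ((h1.sub (hasDerivAt_one_div_pow (e l) ht.ne')).const_mul (c l)).congr_deriv ?_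
      have : ((e l).factorial : ℝ) ≠ 0 := by positivity
      rw [← mul_assoc, div_mul_cancel₀ _ this]
      ring
    exact ((hderiv t ht).sub (HasDerivAt.fun_sum h)).const_mul ε
  · exact (((hf t ht).sub (HasLaplaceAt.sum fun l _ =>
      (HasLaplaceAt.pow_mul_one_sub_exp (e l) ht).const_mul _)).const_mul ε).pos hsign
  · have h := ((hlim t ht).sub (tendsto_sum_mul_one_div_pow_add_nat s c e he t)).const_mul ε
    simpa using h

theorem sum_Icc_one_eq_sum_range (N : ℕ) (f : ℕ → ℝ) :
    ∑ l ∈ Finset.Icc 1 N, f l = ∑ j ∈ Finset.range N, f (j + 1) := by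
  induction N with
  | zero => simp
  | succ N ih => rw [Finset.sum_Icc_succ_top (by omega), ih, Finset.sum_range_succ]

/-- Pulling out `exp (-(u / 2))` centres the exponents at `1/2`, where the symmetry `y ↦ 1 - y`
produces `sinh` and `cosh`. -/
theorem exp_neg_eq_exp_half_mul_exp (u y : ℝ) :
    Real.exp (-(y * u)) = Real.exp (-(u / 2)) * Real.exp ((1 / 2 - y) * u) := by
  rw [← Real.exp_add]
  ring_nf

theorem one_sub_exp_neg_eq (u : ℝ) :
    1 - Real.exp (-u) = 2 * Real.exp (-(u / 2)) * Real.sinh (u / 2) := by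
  rw [Real.sinh_eq, mul_div_assoc', mul_sub, mul_assoc, mul_assoc, ← Real.exp_add,
    ← Real.exp_add, neg_add_cancel, Real.exp_zero]
  ring_nf

theorem one_add_exp_neg_eq (u : ℝ) :
    1 + Real.exp (-u) = 2 * Real.exp (-(u / 2)) * Real.cosh (u / 2) := by
  rw [Real.cosh_eq, mul_div_assoc', mul_add, mul_assoc, mul_assoc, ← Real.exp_add,
    ← Real.exp_add, neg_add_cancel, Real.exp_zero]
  ring_nf

theorem exp_neg_sub_exp_neg_eq (u x : ℝ) :
    Real.exp (-((1 - x) * u)) - Real.exp (-(x * u)) =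
      2 * Real.exp (-(u / 2)) * Real.sinh ((x - 1 / 2) * u) := by
  rw [exp_neg_eq_exp_half_mul_exp u (1 - x), exp_neg_eq_exp_half_mul_exp u x, Real.sinh_eq]
  ring_nf

theorem exp_neg_add_exp_neg_eq (u x : ℝ) :
    Real.exp (-((1 - x) * u)) + Real.exp (-(x * u)) =
      2 * Real.exp (-(u / 2)) * Real.cosh ((x - 1 / 2) * u) := by
  rw [exp_neg_eq_exp_half_mul_exp u (1 - x), exp_neg_eq_exp_half_mul_exp u x, Real.cosh_eq]
  ring_nf

/-- The kernel of `(1 - 2 * x) * log t` is exactly the `B_1` term of the expansion, which is why `N`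
terms on the left give a remainder of order `N + 1`. -/
theorem odd_kernel_eq {u : ℝ} (hu : 0 < u) (N : ℕ) (x : ℝ) :
    Real.exp (-((1 - x) * u)) - Real.exp (-(x * u)) - (1 - 2 * x) * (Real.exp (-(1 * u)) - 1) -
      ∑ l ∈ Finset.Icc 1 N, bernoulliFun (2 * l + 1) x / ((l : ℝ) * (2 * (l : ℝ) + 1)) *
        ((2 * l : ℕ) : ℝ) / (2 * l).factorial * (u ^ (2 * l) * (1 - Real.exp (-u))) =
    (1 - Real.exp (-u)) * (2 / u) * bernoulliOddRem u (N + 1) x := by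
  have hs : Real.sinh (u / 2) ≠ 0 := (Real.sinh_pos_iff.2 (by linarith)).ne'
  have hsum : ∑ l ∈ Finset.Icc 1 N, bernoulliFun (2 * l + 1) x / ((l : ℝ) * (2 * (l : ℝ) + 1)) *
        ((2 * l : ℕ) : ℝ) / (2 * l).factorial * (u ^ (2 * l) * (1 - Real.exp (-u))) =
      (1 - Real.exp (-u)) * (2 / u) * ∑ j ∈ Finset.range N,
        bernoulliFun (2 * (j + 1) + 1) x * u ^ (2 * (j + 1) + 1) /
          (2 * (j + 1) + 1).factorial := by
    rw [sum_Icc_one_eq_sum_range, Finset.mul_sum]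
    refine Finset.sum_congr rfl fun j _ => ?_
    rw [Nat.factorial_succ (2 * (j + 1))]
    have h1 : ((2 * (j + 1)).factorial : ℝ) ≠ 0 := by positivity
    have h2 : ((j : ℝ) + 1) ≠ 0 := by positivity
    have h3 : (2 * ((j : ℝ) + 1) + 1) ≠ 0 := by positivity
    push_cast
    field_simp
    ring
  rw [hsum, bernoulliOddRem, Finset.sum_range_succ', exp_neg_sub_exp_neg_eq, one_mul]
  simp only [mul_zero, zero_add, bernoulliFun_one, pow_one, Nat.factorial_one, Nat.cast_one,
    div_one]
  have h4 : 2 * Real.exp (-(u / 2)) * Real.sinh ((x - 1 / 2) * u) =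
      (1 - Real.exp (-u)) * (2 / u) *
        (u * Real.sinh ((x - 1 / 2) * u) / (2 * Real.sinh (u / 2))) := by
    rw [one_sub_exp_neg_eq]
    field_simp
  rw [h4]
  have h5 : (1 - 2 * x) * (Real.exp (-u) - 1) =
      (1 - Real.exp (-u)) * (2 / u) * ((x - 1 / 2) * u) := by
    field_simp
    ring
  rw [h5]
  ring

/-- No order shift occurs here: the constant term `B_0(x) - B_0` is zero, and subtracting `B_{2l}`
matches the normalization of the even remainder. -/
theorem even_kernel_eq {u : ℝ} (hu : 0 < u) (N : ℕ) (x : ℝ) :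
    Real.exp (-((1 - x) * u)) + Real.exp (-(x * u)) - 1 - Real.exp (-(1 * u)) -
      ∑ l ∈ Finset.Icc 1 N, (bernoulliFun (2 * l) x - (bernoulli (2 * l) : ℝ)) /
        ((l : ℝ) * (2 * (l : ℝ) - 1)) *
        ((2 * l - 1 : ℕ) : ℝ) / (2 * l - 1).factorial * (u ^ (2 * l - 1) * (1 - Real.exp (-u))) =
    (1 - Real.exp (-u)) * (2 / u) * bernoulliEvenRem u N x := by
  have hs : Real.sinh (u / 2) ≠ 0 := (Real.sinh_pos_iff.2 (by linarith)).ne'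
  have hsum : ∑ l ∈ Finset.Icc 1 N, (bernoulliFun (2 * l) x - (bernoulli (2 * l) : ℝ)) /
        ((l : ℝ) * (2 * (l : ℝ) - 1)) *
        ((2 * l - 1 : ℕ) : ℝ) / (2 * l - 1).factorial *
          (u ^ (2 * l - 1) * (1 - Real.exp (-u))) =
      (1 - Real.exp (-u)) * (2 / u) * ∑ j ∈ Finset.range N,
        (bernoulliFun (2 * (j + 1)) x - bernoulli (2 * (j + 1))) *
          u ^ (2 * (j + 1)) / (2 * (j + 1)).factorial := by
    rw [sum_Icc_one_eq_sum_range, Finset.mul_sum]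
    refine Finset.sum_congr rfl fun j _ => ?_
    have h0 : 2 * (j + 1) - 1 = 2 * j + 1 := by omega
    have hfac : ((2 * (j + 1)).factorial : ℝ) = (2 * ((j : ℝ) + 1)) * (2 * j + 1).factorial := by
      rw [show 2 * (j + 1) = (2 * j + 1) + 1 by ring, Nat.factorial_succ]
      push_cast
      ring
    have hpow : u ^ (2 * (j + 1)) = u * u ^ (2 * j + 1) := by ring
    rw [h0, hfac, hpow]
    have h1 : ((2 * j + 1).factorial : ℝ) ≠ 0 := by positivity
    have h2 : ((j : ℝ) + 1) ≠ 0 := by positivity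
    have h3 : 2 * ((j : ℝ) + 1) - 1 = 2 * j + 1 := by ring
    have h4 : 2 * (j : ℝ) + 1 ≠ 0 := by positivity
    push_cast
    rw [h3]
    field_simp
  rw [hsum, bernoulliEvenRem, one_mul, sub_sub _ (1 : ℝ) (Real.exp (-u)), exp_neg_add_exp_neg_eq,
    one_add_exp_neg_eq]
  have h4 : 2 * Real.exp (-(u / 2)) * Real.cosh ((x - 1 / 2) * u) -
      2 * Real.exp (-(u / 2)) * Real.cosh (u / 2) =
      (1 - Real.exp (-u)) * (2 / u) *
        (u * (Real.cosh ((x - 1 / 2) * u) - Real.cosh (u / 2)) / (2 * Real.sinh (u / 2))) := by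
    rw [one_sub_exp_neg_eq]
    field_simp
  rw [h4]
  ring

theorem one_sub_exp_neg_mul_two_div_pos {u : ℝ} (hu : 0 < u) :
    0 < (1 - Real.exp (-u)) * (2 / u) := by
  have : Real.exp (-u) < 1 := by simpa using hu
  have h2 : 0 < 1 - Real.exp (-u) := by linarith
  positivity

/-- The factorials cancel, and `(t + 1 - x) - (t + x) = 1 - 2 * x` is the power of `n` compensated
by the last logarithm. -/
theorem tendsto_log_Gamma_sub_log_Gamma {x t : ℝ} (hx : x ∈ Ioo (0 : ℝ) (1 / 2)) (ht : 0 < t) :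
    Tendsto (fun n : ℕ => Real.log (Real.Gamma (t + n + 1 - x)) - Real.log (Real.Gamma (t + n + x))
      - (1 - 2 * x) * Real.log (t + n)) atTop (𝓝 0) := by
  rw [← tendsto_add_atTop_iff_nat 1]
  have h := ((tendsto_log_Gamma_add_nat (a := t + 1 - x) (by linarith [hx.2])).sub
    (tendsto_log_Gamma_add_nat (a := t + x) (by linarith [hx.1]))).sub
    ((tendsto_log_add_nat_sub_log t).const_mul (1 - 2 * x))
  simp only [sub_zero, mul_zero] at h
  refine h.congr fun n => ?_
  have h1 : t + 1 - x + ((n + 1 : ℕ) : ℝ) = t + ((n + 1 : ℕ) : ℝ) + 1 - x := by ring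
  have h2 : t + x + ((n + 1 : ℕ) : ℝ) = t + ((n + 1 : ℕ) : ℝ) + x := by ring
  rw [h1, h2]
  ring

/-- Both factorials and powers of `n` cancel because `(t + 1 - x) + (t + x) = t + (t + 1)`. -/
theorem tendsto_log_Gamma_add_log_Gamma {x t : ℝ} (hx : x ∈ Ioo (0 : ℝ) (1 / 2)) (ht : 0 < t) :
    Tendsto (fun n : ℕ => Real.log (Real.Gamma (t + n + 1 - x)) + Real.log (Real.Gamma (t + n + x))
      - Real.log (Real.Gamma (t + n)) - Real.log (Real.Gamma (t + n + 1))) atTop (𝓝 0) := by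
  rw [← tendsto_add_atTop_iff_nat 1]
  have h := (((tendsto_log_Gamma_add_nat (a := t + 1 - x) (by linarith [hx.2])).add
    (tendsto_log_Gamma_add_nat (a := t + x) (by linarith [hx.1]))).sub
    (tendsto_log_Gamma_add_nat ht)).sub (tendsto_log_Gamma_add_nat (a := t + 1) (by linarith))
  simp only [sub_zero, add_zero] at h
  refine h.congr fun n => ?_
  have h1 : t + 1 - x + ((n + 1 : ℕ) : ℝ) = t + ((n + 1 : ℕ) : ℝ) + 1 - x := by ring
  have h2 : t + x + ((n + 1 : ℕ) : ℝ) = t + ((n + 1 : ℕ) : ℝ) + x := by ring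
  have h3 : t + 1 + ((n + 1 : ℕ) : ℝ) = t + ((n + 1 : ℕ) : ℝ) + 1 := by ring
  rw [h1, h2, h3]
  ring

theorem log_Gamma_sub_log_Gamma_sign (N : ℕ) {t x : ℝ} (ht : 0 < t)
    (hx : x ∈ Ioo (0 : ℝ) (1 / 2)) :
    0 < (-1) ^ N * (Real.log (Real.Gamma (t + 1 - x)) - Real.log (Real.Gamma (t + x))
      - (1 - 2 * x) * Real.log t - ∑ l ∈ Finset.Icc 1 N,
        bernoulliFun (2 * l + 1) x / ((l : ℝ) * (2 * (l : ℝ) + 1)) * (1 / t ^ (2 * l))) := by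
  obtain ⟨hx0, hx1⟩ := id hx
  refine mul_sub_sum_pos_of_hasLaplaceAt
    (G := fun t => Real.log (Real.Gamma (t + 1 - x)) - Real.log (Real.Gamma (t + x))
      - (1 - 2 * x) * Real.log t)
    (Δ := fun t => Real.log (t + (1 - x)) - Real.log (t + x)
      - (1 - 2 * x) * (Real.log (t + 1) - Real.log t))
    (d := fun t => 1 / (t + (1 - x)) - 1 / (t + x) - (1 - 2 * x) * (1 / (t + 1) - 1 / t))
    (f := fun u => Real.exp (-((1 - x) * u)) - Real.exp (-(x * u))
      - (1 - 2 * x) * (Real.exp (-(1 * u)) - 1))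
    (e := fun l => 2 * l)
    (fun t ht => ?_) (fun t ht => ?_) (fun t ht => ?_)
    (fun t ht => tendsto_log_Gamma_sub_log_Gamma hx ht) (fun l hl => ?_) (fun u hu => ?_) ht
  · have h1 := log_Gamma_add_one (s := t + (1 - x)) (by linarith)
    have h2 := log_Gamma_add_one (s := t + x) (by linarith)
    have h3 : t + 1 + 1 - x = t + (1 - x) + 1 := by ring
    have h4 : t + 1 + x = t + x + 1 := by ring
    have h5 : t + 1 - x = t + (1 - x) := by ring
    simp only [h3, h4, h5, h1, h2]
    ring
  · have h (a : ℝ) (ha : 0 < t + a) : HasDerivAt (fun s => Real.log (s + a)) (1 / (t + a)) t :=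
      ((hasDerivAt_id t).add_const a).log ha.ne'
    have h0 : HasDerivAt Real.log (1 / t) t := by simpa using Real.hasDerivAt_log ht.ne'
    exact ((h (1 - x) (by linarith)).sub (h x (by linarith))).sub
      (((h 1 (by linarith)).sub h0).const_mul (1 - 2 * x))
  · exact ((HasLaplaceAt.exp_neg (by linarith)).sub (HasLaplaceAt.exp_neg (by linarith))).sub
      (((HasLaplaceAt.exp_neg (by linarith)).sub (HasLaplaceAt.one ht)).const_mul _)
  · have := (Finset.mem_Icc.1 hl).1
    omega
  · rw [odd_kernel_eq hu, mul_left_comm]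
    refine mul_pos (one_sub_exp_neg_mul_two_div_pos hu) ?_
    -- Order `N + 1` carries the sign `(-1) ^ (N + 2)`, which is `(-1) ^ N`.
    simpa [pow_succ] using bernoulliOddRem_sign hu (N + 1) x hx

theorem log_Gamma_add_log_Gamma_sign (N : ℕ) {t x : ℝ} (ht : 0 < t)
    (hx : x ∈ Ioo (0 : ℝ) (1 / 2)) :
    0 < (-1) ^ (N + 1) * (Real.log (Real.Gamma (t + 1 - x)) + Real.log (Real.Gamma (t + x))
      - Real.log (Real.Gamma t) - Real.log (Real.Gamma (t + 1)) - ∑ l ∈ Finset.Icc 1 N,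
        (bernoulliFun (2 * l) x - (bernoulli (2 * l) : ℝ)) / ((l : ℝ) * (2 * (l : ℝ) - 1))
            * (1 / t ^ (2 * l - 1))) := by
  obtain ⟨hx0, hx1⟩ := id hx
  refine mul_sub_sum_pos_of_hasLaplaceAt
    (G := fun t => Real.log (Real.Gamma (t + 1 - x)) + Real.log (Real.Gamma (t + x))
      - Real.log (Real.Gamma t) - Real.log (Real.Gamma (t + 1)))
    (Δ := fun t => Real.log (t + (1 - x)) + Real.log (t + x) - Real.log t - Real.log (t + 1))
    (d := fun t => 1 / (t + (1 - x)) + 1 / (t + x) - 1 / t - 1 / (t + 1))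
    (f := fun u => Real.exp (-((1 - x) * u)) + Real.exp (-(x * u)) - 1 - Real.exp (-(1 * u)))
    (e := fun l => 2 * l - 1)
    (fun t ht => ?_) (fun t ht => ?_) (fun t ht => ?_)
    (fun t ht => tendsto_log_Gamma_add_log_Gamma hx ht) (fun l hl => ?_) (fun u hu => ?_) ht
  · have h1 := log_Gamma_add_one (s := t + (1 - x)) (by linarith)
    have h2 := log_Gamma_add_one (s := t + x) (by linarith)
    have h3 : t + 1 + 1 - x = t + (1 - x) + 1 := by ring
    have h4 : t + 1 + x = t + x + 1 := by ring
    have h5 : t + 1 - x = t + (1 - x) := by ring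
    have h6 := log_Gamma_add_one (s := t + 1) (by linarith)
    simp only [h3, h4, h5, h1, h2, h6, log_Gamma_add_one ht]
    ring
  · have h (a : ℝ) (ha : 0 < t + a) : HasDerivAt (fun s => Real.log (s + a)) (1 / (t + a)) t :=
      ((hasDerivAt_id t).add_const a).log ha.ne'
    have h0 : HasDerivAt Real.log (1 / t) t := by simpa using Real.hasDerivAt_log ht.ne'
    exact (((h (1 - x) (by linarith)).add (h x (by linarith))).sub h0).sub (h 1 (by linarith))
  · exact (((HasLaplaceAt.exp_neg (by linarith)).add (HasLaplaceAt.exp_neg (by linarith))).sub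
      (HasLaplaceAt.one ht)).sub (HasLaplaceAt.exp_neg (by linarith))
  · have := (Finset.mem_Icc.1 hl).1
    omega
  · rw [even_kernel_eq hu, mul_left_comm]
    exact mul_pos (one_sub_exp_neg_mul_two_div_pos hu) (bernoulliEvenRem_sign hu N hx)

theorem theorem3p3 (m₁ m₂ : ℕ) (t x : ℝ) (ht : 0 < t) (hx : x ∈ Set.Ioo (0 : ℝ) (1 / 2)) :
    (Real.exp (∑ l ∈ Finset.Icc 1 (2 * m₁ + 1),
          (bernoulliFun (2 * l) x - (bernoulli (2 * l) : ℝ)) / ((l : ℝ) * (2 * (l : ℝ) - 1))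
            * (1 / t ^ (2 * l - 1)))
        < Real.Gamma (t + 1 - x) * Real.Gamma (t + x) / (Real.Gamma t * Real.Gamma (t + 1)) ∧
      Real.Gamma (t + 1 - x) * Real.Gamma (t + x) / (Real.Gamma t * Real.Gamma (t + 1))
        < Real.exp (∑ l ∈ Finset.Icc 1 (2 * m₂),
          (bernoulliFun (2 * l) x - (bernoulli (2 * l) : ℝ)) / ((l : ℝ) * (2 * (l : ℝ) - 1))
            * (1 / t ^ (2 * l - 1)))) ∧
    (Real.exp (∑ l ∈ Finset.Icc 1 (2 * m₁),
          bernoulliFun (2 * l + 1) x / ((l : ℝ) * (2 * (l : ℝ) + 1)) * (1 / t ^ (2 * l)))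
        < Real.Gamma (t + 1 - x) / (t ^ (1 - 2 * x) * Real.Gamma (t + x)) ∧
      Real.Gamma (t + 1 - x) / (t ^ (1 - 2 * x) * Real.Gamma (t + x))
        < Real.exp (∑ l ∈ Finset.Icc 1 (2 * m₂ + 1),
          bernoulliFun (2 * l + 1) x / ((l : ℝ) * (2 * (l : ℝ) + 1)) * (1 / t ^ (2 * l)))) := by
  obtain ⟨hx0, hx1⟩ := id hx
  have hA : 0 < Real.Gamma (t + 1 - x) := Real.Gamma_pos_of_pos (by linarith)
  have hB : 0 < Real.Gamma (t + x) := Real.Gamma_pos_of_pos (by linarith)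
  have hC : 0 < Real.Gamma t := Real.Gamma_pos_of_pos ht
  have hD : 0 < Real.Gamma (t + 1) := Real.Gamma_pos_of_pos (by linarith)
  have hE : 0 < t ^ (1 - 2 * x) := Real.rpow_pos_of_pos ht _
  have hlog_even : Real.log (Real.Gamma (t + 1 - x) * Real.Gamma (t + x) /
      (Real.Gamma t * Real.Gamma (t + 1))) = Real.log (Real.Gamma (t + 1 - x)) +
        Real.log (Real.Gamma (t + x)) - Real.log (Real.Gamma t) -
        Real.log (Real.Gamma (t + 1)) := by
    rw [Real.log_div (mul_pos hA hB).ne' (mul_pos hC hD).ne', Real.log_mul hA.ne' hB.ne',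
      Real.log_mul hC.ne' hD.ne']
    ring
  have hlog_odd : Real.log (Real.Gamma (t + 1 - x) / (t ^ (1 - 2 * x) * Real.Gamma (t + x))) =
      Real.log (Real.Gamma (t + 1 - x)) - Real.log (Real.Gamma (t + x)) -
        (1 - 2 * x) * Real.log t := by
    rw [Real.log_div hA.ne' (mul_pos hE hB).ne', Real.log_mul hE.ne' hB.ne', Real.log_rpow ht]
    ring
  -- The two families have opposite signs for equal truncation, so the lower bounds use an odd
  -- number of terms in the first and an even number in the second.
  have hpow (m : ℕ) : (-1 : ℝ) ^ (2 * m) = 1 := by rw [pow_mul]; simp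
  refine ⟨⟨?_, ?_⟩, ?_, ?_⟩
  · rw [← Real.lt_log_iff_exp_lt (by positivity), hlog_even]
    have h := log_Gamma_add_log_Gamma_sign (2 * m₁ + 1) ht hx
    rw [pow_succ, pow_succ, hpow] at h
    linarith
  · rw [← Real.log_lt_iff_lt_exp (by positivity), hlog_even]
    have h := log_Gamma_add_log_Gamma_sign (2 * m₂) ht hx
    rw [pow_succ, hpow] at h
    linarith
  · rw [← Real.lt_log_iff_exp_lt (by positivity), hlog_odd]
    have h := log_Gamma_sub_log_Gamma_sign (2 * m₁) ht hx
    rw [hpow] at h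
    linarith
  · rw [← Real.log_lt_iff_lt_exp (by positivity), hlog_odd]
    have h := log_Gamma_sub_log_Gamma_sign (2 * m₂ + 1) ht hx
    rw [pow_succ, hpow] at h
    linarith
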